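/- **Theorem (Qualitative overlap detection via the Poisson energy).** Let $R\subset\mathbb R^2$ be a bounded domain with $C^\infty$ boundary, let $M_1,\dots,M_n\subset\mathbb R^2$ be bounded Lipschitz domains with areas $A_i=|M_i|$, and let $c=(c_1,\dots,c_n)\in(\mathbb R^2)^n$. Let $\eta\in C_c^\infty(\mathbb R^2)$ satisfy $\eta\ge 0$, $\int_{\mathbb R^2}\eta=1$ and $\operatorname{supp}\eta\subset\{|x|\le 1\}$. For $\varepsilon>0$ put $\eta_\varepsilon(x)=\varepsilon^{-2}\eta(x/\varepsilon)$, $\psi_i^\varepsilon=\eta_\varepsilon*\mathbf 1_{M_i}$, and $$\rho_\varepsilon(x;c)=\sum_{i=1}^n\psi_i^\varepsilon(x-c_i),\qquad \bar\rho=\frac1{|R|}\sum_{i=1}^nA_i,\qquad \mathcal O(c)=\bigcup_{i<j}\big((M_i+c_i)\cap(M_j+c_j)\big).$$ Assume that * $\bar\rho<2$; * $0<\varepsilon<\operatorname{inrad}(M_i)$ for every $i$, where $\operatorname{inrad}(M)$ is the supremum of the radii of the discs contained in $M$; * the mollified modules lie in the region: for every $i$, the function $x\mapsto\psi_i^\varepsilon(x-c_i)$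 vanishes outside $\overline R$. Let $\phi_\varepsilon\in H^1(R)$ be the unique weak solution of the Neumann problem $-\Delta\phi_\varepsilon=\rho_\varepsilon(\cdot;c)-\bar\rho$ in $R$, $\partial\phi_\varepsilon/\partial n=0$ on $\partial R$, $\int_R\phi_\varepsilon=0$; that is, $\int_R\nabla\phi_\varepsilon\cdot\nabla v\,dx=\int_R(\rho_\varepsilon(\cdot;c)-\bar\rho)\,v\,dx$ for all $v\in H^1(R)$ and $\int_R\phi_\varepsilon=0$. Let $$E_\varepsilon(c)=\frac12\int_R|\nabla\phi_\varepsilon|^2\,dx=\frac12\int_R\phi_\varepsilon\,(\rho_\varepsilon(\cdot;c)-\bar\rho)\,dx$$ be the mollified Poisson energy. Then $$|\mathcal O(c)|>0\ \Longrightarrow\ E_\varepsilon(c)>0 .$$ -/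

import Mathlib

open MeasureTheory Set
open scoped ContDiff

namespace Floorplan

/-- The Euclidean plane. -/
abbrev Plane : Type := EuclideanSpace ℝ (Fin 2)

/-! ### Domains -/

/-- A bounded domain: a nonempty, open, connected, bounded subset of the plane. -/
structure IsBoundedDomain (Ω : Set Plane) : Prop where
  isOpen : IsOpen Ω
  isConnected : IsConnected Ω
  isBounded : Bornology.IsBounded Ω

/-- Near each of its boundary points, and after a rotation or reflection of the coordinates,
`Ω` is the region above the graph of a function `γ : ℝ → ℝ` of class `P`. -/
def HasGraphBoundary (P : (ℝ → ℝ) → Prop) (Ω : Set Plane) : Prop :=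
  ∀ p ∈ frontier Ω, ∃ (A : Plane ≃ₗᵢ[ℝ] Plane) (γ : ℝ → ℝ) (r : ℝ), P γ ∧ 0 < r ∧
    ∀ x ∈ Metric.ball p r, x ∈ Ω ↔ γ (A x 0) < A x 1

/-- A bounded domain with smooth (`C^∞`) boundary. -/
def IsSmoothBoundedDomain (Ω : Set Plane) : Prop :=
  IsBoundedDomain Ω ∧ HasGraphBoundary (fun γ => ContDiff ℝ ∞ γ) Ω

/-- A bounded Lipschitz domain. -/
def IsLipschitzBoundedDomain (Ω : Set Plane) : Prop :=
  IsBoundedDomain Ω ∧ HasGraphBoundary (fun γ => ∃ K, LipschitzWith K γ) Ω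

/-- The area of a set. -/
noncomputable def area (S : Set Plane) : ℝ := volume.real S

/-- The inradius: the supremum of the radii of the discs contained in the set. -/
noncomputable def inradius (S : Set Plane) : ℝ :=
  sSup {r : ℝ | ∃ x, Metric.ball x r ⊆ S}

/-! ### Mollified densities -/

/-- A mollifier: smooth, nonnegative, of integral one, supported in the unit disc. -/
structure IsMollifier (η : Plane → ℝ) : Prop where
  contDiff : ContDiff ℝ ∞ η
  nonneg : ∀ x, 0 ≤ η x
  integral_eq_one : ∫ x, η x = 1
  tsupport_subset : tsupport η ⊆ Metric.closedBall 0 1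

/-- The scaled mollifier `η_ε(x) = ε⁻² η(x/ε)`. -/
noncomputable def scaledMollifier (η : Plane → ℝ) (ε : ℝ) (x : Plane) : ℝ :=
  1 / ε ^ 2 * η (ε⁻¹ • x)

/-- The mollified indicator function `η_ε * 1_M`. -/
noncomputable def mollifiedIndicator (η : Plane → ℝ) (ε : ℝ) (M : Set Plane) (x : Plane) : ℝ :=
  ∫ y, scaledMollifier η ε (x - y) * M.indicator (fun _ => (1 : ℝ)) y

/-- The mollified density `ρ_ε(x; c) = ∑ᵢ (η_ε * 1_{Mᵢ})(x - cᵢ)`. -/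
noncomputable def mollifiedDensity {n : ℕ} (η : Plane → ℝ) (ε : ℝ) (M : Fin n → Set Plane)
    (c : Fin n → Plane) (x : Plane) : ℝ :=
  ∑ i, mollifiedIndicator η ε (M i) (x - c i)

/-- The average density `(∑ᵢ |Mᵢ|) / |R|`. -/
noncomputable def averageDensity {n : ℕ} (R : Set Plane) (M : Fin n → Set Plane) : ℝ :=
  (∑ i, area (M i)) / area R

/-- The geometric overlap set `⋃_{i<j} (Mᵢ + cᵢ) ∩ (Mⱼ + cⱼ)`. -/
def overlap {n : ℕ} (M : Fin n → Set Plane) (c : Fin n → Plane) : Set Plane :=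
  ⋃ (i : Fin n) (j : Fin n) (_ : i < j),
    ((fun x => x + c i) '' M i) ∩ ((fun x => x + c j) '' M j)

/-! ### The Neumann problem -/

/-- `G` is the weak gradient of `u` on the open set `R`. -/
def HasWeakGradient (R : Set Plane) (u : Plane → ℝ) (G : Plane → Plane) : Prop :=
  ∀ θ : Plane → ℝ, ContDiff ℝ ∞ θ → HasCompactSupport θ → tsupport θ ⊆ R →
    ∀ e : Plane, ∫ x in R, u x * fderiv ℝ θ x e = -∫ x in R, inner ℝ (G x) e * θ x

/-- `u` belongs to the Sobolev space `H¹(R)`, with weak gradient `G`. -/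
structure IsSobolev (R : Set Plane) (u : Plane → ℝ) (G : Plane → Plane) : Prop where
  memLp : MemLp u 2 (volume.restrict R)
  memLp_grad : MemLp G 2 (volume.restrict R)
  hasWeakGradient : HasWeakGradient R u G

/-- `φ ∈ H¹(R)`, with weak gradient `G`, is the weak solution of the Neumann problem
`-Δφ = f` in `R`, `∂φ/∂n = 0` on `∂R`, `∫_R φ = 0`. -/
structure IsNeumannSolution (R : Set Plane) (f : Plane → ℝ) (φ : Plane → ℝ)
    (G : Plane → Plane) : Prop where
  isSobolev : IsSobolev R φ G
  weak_eq : ∀ (v : Plane → ℝ) (H : Plane → Plane), IsSobolev R v H →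
    ∫ x in R, inner ℝ (G x) (H x) = ∫ x in R, f x * v x
  integral_eq_zero : ∫ x in R, φ x = 0

open Classical in
/-- The solution of the Neumann problem with right-hand side `f`, together with its weak
gradient (and zero if the problem has no solution). -/
noncomputable def neumannPotential (R : Set Plane) (f : Plane → ℝ) :
    (Plane → ℝ) × (Plane → Plane) :=
  if h : ∃ p : (Plane → ℝ) × (Plane → Plane), IsNeumannSolution R f p.1 p.2 then h.choose
  else (0, 0)

/-- The energy `½ ∫_R |∇φ|²` of the solution `φ` of the Neumann problem with right-hand side
`f`. Without a solution its value is `0`, so that its positivity includes solvability. -/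
noncomputable def neumannEnergy (R : Set Plane) (f : Plane → ℝ) : ℝ :=
  1 / 2 * ∫ x in R, ‖(neumannPotential R f).2 x‖ ^ 2

/-- The energy does not depend on the representative of the solution that is used, and it
equals `½ ∫_R φ f`. -/
theorem neumannEnergy_eq {R : Set Plane} {f φ : Plane → ℝ} {G : Plane → Plane}
    (h : IsNeumannSolution R f φ G) :
    neumannEnergy R f = 1 / 2 * ∫ x in R, ‖G x‖ ^ 2 ∧
      neumannEnergy R f = 1 / 2 * ∫ x in R, φ x * f x := by
  have hex : ∃ p : (Plane → ℝ) × (Plane → Plane), IsNeumannSolution R f p.1 p.2 := ⟨(φ, G), h⟩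
  have hs : IsNeumannSolution R f (neumannPotential R f).1 (neumannPotential R f).2 := by
    unfold neumannPotential
    rw [dif_pos hex]
    exact hex.choose_spec
  have h11 := h.weak_eq _ _ h.isSobolev
  have h12 := h.weak_eq _ _ hs.isSobolev
  have h21 := hs.weak_eq _ _ h.isSobolev
  have h22 := hs.weak_eq _ _ hs.isSobolev
  simp only [real_inner_self_eq_norm_sq] at h11 h22
  simp only [real_inner_comm] at h12 h21
  have hcomm : ∫ x in R, inner ℝ (G x) ((neumannPotential R f).2 x)
      = ∫ x in R, inner ℝ ((neumannPotential R f).2 x) (G x) := by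
    simp only [real_inner_comm]
  have hmul : ∫ x in R, φ x * f x = ∫ x in R, f x * φ x := by
    simp only [mul_comm]
  unfold neumannEnergy
  constructor <;> linarith

/-- The mollified Poisson energy `E_ε(c)`: the energy of the solution of the Neumann problem
whose right-hand side is the residual `ρ_ε(·; c)` minus the average density. -/
noncomputable def mollifiedPoissonEnergy {n : ℕ} (R : Set Plane) (η : Plane → ℝ) (ε : ℝ)
    (M : Fin n → Set Plane) (c : Fin n → Plane) : ℝ :=
  neumannEnergy R (fun x => mollifiedDensity η ε M c x - averageDensity R M)

end Floorplan

namespace Floorplan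

/-! If the energy vanished, the weak gradient of the potential would vanish almost everywhere, so
the residual would integrate to zero against every test function in `R`. Being continuous, the
residual would vanish on `R`, and by continuity also on its boundary. But each mollified module is
continuous and vanishes off the closure of `R`. Since `R` locally lies on one side of a graph, the
modules vanish on the boundary too, where the residual is therefore minus the average density. That
average is positive as soon as there is one module, which an overlap of positive area guarantees.

Most of the work is solvability of the Neumann problem, without which the energy would take its
default value zero. It is a coercive variational problem on the mean-zero part of H¹
(`exists_isNeumannSolution`), and coercivity is the Poincaré inequality (`poincareOn_self`). That
inequality rests on the L² bound for translates (`IsSobolev.eLpNorm_sub_translate_le`): averaging it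
over translations gives balls, chains of overlapping balls give compact subsets, and a shift into
the interior handles the boundary. -/

/-! ### L² bounds for translates of H¹ functions. -/

theorem abs_integral_mul_le_of_memLp {α : Type*} [MeasurableSpace α] {μ : Measure α} {f g : α → ℝ}
    (hf : MemLp f 2 μ) (hg : MemLp g 2 μ) :
    |∫ x, f x * g x ∂μ| ≤ (eLpNorm f 2 μ).toReal * (eLpNorm g 2 μ).toReal := by
  have h := abs_real_inner_le_norm (hg.toLp g) (hf.toLp f)
  rw [L2.inner_def, Lp.norm_toLp, Lp.norm_toLp, mul_comm] at h
  convert h using 2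
  apply integral_congr_ae
  filter_upwards [hf.coeFn_toLp, hg.coeFn_toLp] with x h1 h2
  simp [h1, h2]

/-- A bound on the pairing with all test functions supported in `U` bounds the `L²` norm. -/
theorem eLpNorm_le_of_forall_integral_mul_le {U : Set Plane} (hU : IsOpen U) {w : Plane → ℝ}
    (hw : MemLp w 2 (volume.restrict U)) {C : ℝ}
    (h : ∀ θ : Plane → ℝ, ContDiff ℝ ∞ θ → HasCompactSupport θ → tsupport θ ⊆ U →
      ∫ x in U, w x * θ x ≤ C * (eLpNorm θ 2 (volume.restrict U)).toReal) :
    eLpNorm w 2 (volume.restrict U) ≤ ENNReal.ofReal C := by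
  let S : Set (Lp ℝ 2 (volume.restrict U)) :=
    {f | ∃ θ : Plane → ℝ, ContDiff ℝ ∞ θ ∧ HasCompactSupport θ ∧ tsupport θ ⊆ U ∧
      (f : Plane → ℝ) =ᵐ[volume.restrict U] θ}
  let T : Submodule ℝ (Lp ℝ 2 (volume.restrict U)) :=
    { carrier := S
      zero_mem' := ⟨0, contDiff_const, HasCompactSupport.zero, by simp [tsupport], Lp.coeFn_zero ..⟩
      add_mem' := by
        rintro f g ⟨θ, h1, h2, h3, h4⟩ ⟨χ, k1, k2, k3, k4⟩
        refine ⟨θ + χ, h1.add k1, h2.add k2, (tsupport_add _ _).trans (union_subset h3 k3), ?_⟩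
        exact (Lp.coeFn_add f g).trans (h4.add k4)
      smul_mem' := by
        rintro c f ⟨θ, h1, h2, h3, h4⟩
        refine ⟨c • θ, h1.const_smul c, h2.smul_left, ?_, ?_⟩
        · exact (closure_mono (Function.support_const_smul_subset c θ)).trans h3
        · exact (Lp.coeFn_smul c f).trans (h4.const_smul c) }
  -- Test functions are dense in L²: a function orthogonal to all of them vanishes almost
  -- everywhere.
  have hT : T.topologicalClosure = ⊤ := by
    rw [Submodule.topologicalClosure_eq_top_iff, Submodule.eq_bot_iff]
    intro g hg
    rw [Submodule.mem_orthogonal] at hg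
    have hg0 : ∀ᵐ x, x ∈ U → g x = 0 := by
      refine hU.ae_eq_zero_of_integral_contDiff_smul_eq_zero ?_ ?_
      · have := (Lp.memLp g).locallyIntegrable (by norm_num)
        refine (locallyIntegrableOn_iff hU.isLocallyClosed).2 fun K hK hKc => ?_
        have h1 := this.integrableOn_isCompact hKc
        rwa [IntegrableOn, Measure.restrict_restrict_of_subset hK] at h1
      · intro θ h1 h2 h3
        have hm : MemLp θ 2 (volume.restrict U) :=
          (h1.continuous.memLp_of_hasCompactSupport h2).restrict U
        have := hg (hm.toLp θ) ⟨θ, h1, h2, h3, hm.coeFn_toLp⟩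
        rw [L2.inner_def] at this
        rw [← setIntegral_eq_integral_of_forall_compl_eq_zero (s := U), ← this]
        · apply integral_congr_ae
          filter_upwards [hm.coeFn_toLp] with x hx
          simp [hx, mul_comm]
        · intro x hx
          rw [image_eq_zero_of_notMem_tsupport (fun hx' => hx (h3 hx')), zero_smul]
    apply Lp.ext
    have := (ae_restrict_iff' hU.measurableSet).2 hg0
    filter_upwards [this, Lp.coeFn_zero ℝ 2 (volume.restrict U)] with x hx h0
    rw [hx, h0]; rfl
  have key : ∀ f : Lp ℝ 2 (volume.restrict U), inner ℝ f (hw.toLp w) ≤ C * ‖f‖ := by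
    have hcl : IsClosed {f : Lp ℝ 2 (volume.restrict U) | inner ℝ f (hw.toLp w) ≤ C * ‖f‖} :=
      isClosed_le (by fun_prop) (by fun_prop)
    have hsub : (T : Set (Lp ℝ 2 (volume.restrict U))) ⊆
        {f | inner ℝ f (hw.toLp w) ≤ C * ‖f‖} := by
      rintro f ⟨θ, h1, h2, h3, h4⟩
      have := h θ h1 h2 h3
      rw [← eLpNorm_congr_ae h4] at this
      simp only [mem_ofPred_eq, L2.inner_def, Lp.norm_def]
      refine le_trans (le_of_eq ?_) this
      apply integral_congr_ae
      filter_upwards [hw.coeFn_toLp, h4] with x hx hx'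
      simp [hx, hx']
    intro f
    have := closure_minimal hsub hcl
    apply this
    rw [← Submodule.topologicalClosure_coe, hT]
    trivial
  have h1 := key (hw.toLp w)
  rw [real_inner_self_eq_norm_mul_norm] at h1
  -- The sign of `C` is not known, so the case of zero norm is split off before cancelling a factor
  -- of the norm.
  have h2 : ‖hw.toLp w‖ ≤ max C 0 := by
    rcases eq_or_lt_of_le (norm_nonneg (hw.toLp w)) with h0 | h0
    · rw [← h0]; exact le_max_right _ _
    · exact (le_of_mul_le_mul_right h1 h0).trans (le_max_left _ _)
  rw [Lp.norm_toLp] at h2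
  rw [← ENNReal.ofReal_toReal hw.eLpNorm_lt_top.ne]
  refine (ENNReal.ofReal_le_ofReal h2).trans ?_
  rw [ENNReal.ofReal_max]; simp

theorem contDiff_fderiv_apply {θ : Plane → ℝ} (h : ContDiff ℝ ∞ θ) (e : Plane) :
    ContDiff ℝ ∞ (fun x => fderiv ℝ θ x e) :=
  (h.fderiv_right (m := ∞) (by simp)).clm_apply contDiff_const

/-- The translated test function is supported in the translate of `U` by `h`, hence still in `R`,
and so is itself admissible. -/
theorem HasWeakGradient.integral_mul_translate {R U : Set Plane} {u : Plane → ℝ} {G : Plane → Plane}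
    (hu : HasWeakGradient R u G) {h : Plane} (hR : ∀ x ∈ U, x + h ∈ R)
    {θ : Plane → ℝ} (h1 : ContDiff ℝ ∞ θ) (h2 : HasCompactSupport θ) (h3 : tsupport θ ⊆ U)
    (e : Plane) :
    ∫ x in R, u x * fderiv ℝ θ (x - h) e = -∫ x in R, inner ℝ (G x) e * θ (x - h) := by
  have ht : tsupport (fun x => θ (x - h)) = (Homeomorph.subRight h) ⁻¹' tsupport θ :=
    tsupport_comp_eq_preimage θ (Homeomorph.subRight h)
  have := hu (fun x => θ (x - h)) (h1.comp (contDiff_id.sub contDiff_const))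
    (h2.comp_homeomorph (Homeomorph.subRight h)) ?_ e
  · rw [← this]
    simp only [fderiv_comp_sub]
  · rw [ht]
    intro x hx
    simpa using hR _ (h3 hx)

/-- The pairing of a difference quotient with a test function is bounded by the gradient. -/
theorem IsSobolev.integral_mul_sub_translate_le {R U : Set Plane} {u : Plane → ℝ}
    {G : Plane → Plane} (hb : volume R ≠ ⊤)
    (hu : IsSobolev R u G) {h : Plane} (hR : ∀ x ∈ U, ∀ s ∈ Icc (0 : ℝ) 1, x + s • h ∈ R)
    {θ : Plane → ℝ} (h1 : ContDiff ℝ ∞ θ) (h2 : HasCompactSupport θ) (h3 : tsupport θ ⊆ U) :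
    (∫ x in R, u x * θ (x - h)) - ∫ x in R, u x * θ x ≤
      ‖h‖ * (eLpNorm G 2 (volume.restrict R)).toReal * (eLpNorm θ 2 volume).toReal := by
  have : IsFiniteMeasure (volume.restrict R) := ⟨by simpa using hb.lt_top⟩
  have hui : Integrable u (volume.restrict R) := hu.memLp.integrable (by norm_num)
  -- `F` interpolates between the two integrals. Its derivative is a pairing with the weak gradient,
  -- so the mean value inequality applies. Only the test function is differentiated.
  let F : ℝ → ℝ := fun s => ∫ x in R, u x * θ (x - s • h)
  have hθ' : ContDiff ℝ ∞ (fun x => fderiv ℝ θ x h) := contDiff_fderiv_apply h1 h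
  have hθ'c : HasCompactSupport (fun x => fderiv ℝ θ x h) := h2.fderiv_apply (𝕜 := ℝ) h
  obtain ⟨B, hB⟩ := hθ'.continuous.bounded_above_of_compact_support hθ'c
  obtain ⟨B0, hB0⟩ := h1.continuous.bounded_above_of_compact_support h2
  have hF : ∀ s : ℝ, HasDerivAt F (∫ x in R, u x * -(fderiv ℝ θ (x - s • h) h)) s := by
    intro s
    refine (hasDerivAt_integral_of_dominated_loc_of_deriv_le (μ := volume.restrict R)
      (F := fun s x => u x * θ (x - s • h)) (F' := fun s x => u x * -(fderiv ℝ θ (x - s • h) h))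
      (bound := fun x => ‖u x‖ * B) (s := univ) Filter.univ_mem ?_ ?_ ?_ ?_ ?_ ?_).2
    · refine Filter.Eventually.of_forall fun t => ?_
      exact hui.1.mul (h1.continuous.comp (by fun_prop)).aestronglyMeasurable
    · exact hui.mul_bdd (c := B0) (h1.continuous.comp (by fun_prop)).aestronglyMeasurable
        (Filter.Eventually.of_forall fun x => hB0 _)
    · exact hui.1.mul (hθ'.continuous.comp (by fun_prop)).neg.aestronglyMeasurable
    · refine Filter.Eventually.of_forall fun x t _ => ?_
      rw [norm_mul, norm_neg]
      exact mul_le_mul_of_nonneg_left (hB _) (norm_nonneg _)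
    · exact hui.norm.mul_const B
    · refine Filter.Eventually.of_forall fun x t _ => ?_
      have hd : HasFDerivAt θ (fderiv ℝ θ (x - t • h)) (x - t • h) :=
        (h1.differentiable (by simp) _).hasFDerivAt
      have hl : HasDerivAt (fun s : ℝ => x - s • h) (-h) t := by
        simpa using ((hasDerivAt_id t).smul_const h).const_sub x
      have := (hd.comp_hasDerivAt t hl).const_mul (u x)
      simpa using this
  have hbound : ∀ s ∈ Ico (0 : ℝ) 1, ‖∫ x in R, u x * -(fderiv ℝ θ (x - s • h) h)‖ ≤
      ‖h‖ * (eLpNorm G 2 (volume.restrict R)).toReal * (eLpNorm θ 2 volume).toReal := by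
    intro s hs
    simp only [mul_neg, integral_neg, norm_neg]
    rw [hu.hasWeakGradient.integral_mul_translate (fun x hx => hR x hx s ⟨hs.1, hs.2.le⟩)
      h1 h2 h3, norm_neg]
    have hm : MemLp θ 2 volume := h1.continuous.memLp_of_hasCompactSupport h2
    have hmp : MeasurePreserving (fun x : Plane => x - s • h) volume volume :=
      measurePreserving_sub_right volume (s • h)
    have hm' : MemLp (fun x => θ (x - s • h)) 2 volume := hm.comp_measurePreserving hmp
    have hn : eLpNorm (fun x => θ (x - s • h)) 2 volume = eLpNorm θ 2 volume :=
      eLpNorm_comp_measurePreserving hm.1 hmp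
    refine (abs_integral_mul_le_of_memLp (hu.memLp_grad.inner_const h) (hm'.restrict R)).trans ?_
    gcongr ?_ * ?_
    · rw [mul_comm]
      refine ENNReal.toReal_le_of_le_ofReal (by positivity) ?_
      rw [mul_comm, ENNReal.ofReal_mul (norm_nonneg _),
        ENNReal.ofReal_toReal hu.memLp_grad.eLpNorm_lt_top.ne]
      refine eLpNorm_le_mul_eLpNorm_of_ae_le_mul (Filter.Eventually.of_forall fun x => ?_) 2
      rw [mul_comm]
      exact norm_inner_le_norm _ _
    · exact ENNReal.toReal_mono hm.eLpNorm_lt_top.ne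
        ((eLpNorm_restrict_le _ _ _ _).trans hn.le)
  have := norm_image_sub_le_of_norm_deriv_le_segment_01' (f := F)
    (fun s _ => (hF s).hasDerivWithinAt) hbound
  refine (le_abs_self _).trans ?_
  simpa [F] using this

/-- By duality it suffices to pair the difference with test functions in `U`; a change of variables
moves the translation onto the test function. -/
theorem IsSobolev.eLpNorm_sub_translate_le {R U : Set Plane} {u : Plane → ℝ} {G : Plane → Plane}
    (hRo : IsOpen R) (hb : volume R ≠ ⊤) (hu : IsSobolev R u G) (hU : IsOpen U) {h : Plane}
    (hR : ∀ x ∈ U, ∀ s ∈ Icc (0 : ℝ) 1, x + s • h ∈ R) :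
    eLpNorm (fun x => u (x + h) - u x) 2 (volume.restrict U) ≤
      ‖h‖ₑ * eLpNorm G 2 (volume.restrict R) := by
  have hUR : U ⊆ R := fun x hx => by simpa using hR x hx 0 (by simp)
  have hUR' : U ⊆ (fun x => x + h) ⁻¹' R := fun x hx => by simpa using hR x hx 1 (by simp)
  have hmp : MeasurePreserving (fun x : Plane => x + h) (volume.restrict ((fun x => x + h) ⁻¹' R))
      (volume.restrict R) :=
    (measurePreserving_add_right volume h).restrict_preimage hRo.measurableSet
  have hw1 : MemLp u 2 (volume.restrict U) := hu.memLp.mono_measure (Measure.restrict_mono hUR le_rfl)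
  have hw2 : MemLp (fun x => u (x + h)) 2 (volume.restrict U) :=
    (hu.memLp.comp_measurePreserving hmp).mono_measure (Measure.restrict_mono hUR' le_rfl)
  have key := eLpNorm_le_of_forall_integral_mul_le hU (hw2.sub hw1)
    (C := ‖h‖ * (eLpNorm G 2 (volume.restrict R)).toReal) ?_
  · refine key.trans (le_of_eq ?_)
    rw [ENNReal.ofReal_mul (norm_nonneg _), ofReal_norm,
      ENNReal.ofReal_toReal hu.memLp_grad.eLpNorm_lt_top.ne]
  · intro θ h1 h2 h3
    have hz : ∀ x ∉ U, θ x = 0 := fun x hx =>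
      image_eq_zero_of_notMem_tsupport (fun hx' => hx (h3 hx'))
    have hm : MemLp θ 2 volume := h1.continuous.memLp_of_hasCompactSupport h2
    have hn : eLpNorm θ 2 (volume.restrict U) = eLpNorm θ 2 volume := by
      rw [eLpNorm_restrict_eq_of_support_subset]
      exact fun x hx => by_contra fun hx' => hx (hz x hx')
    have e1 : ∫ x in R, u x * θ x = ∫ x in U, u x * θ x := by
      refine setIntegral_eq_of_subset_of_forall_sdiff_eq_zero hRo.measurableSet hUR ?_
      intro x hx
      rw [hz x hx.2, mul_zero]
    have e2 : ∫ x in R, u x * θ (x - h) = ∫ x in U, u (x + h) * θ x := by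
      have := hmp.setIntegral_preimage_emb (measurableEmbedding_addRight h)
        (fun x => u x * θ (x - h)) univ
      simp only [preimage_univ, Measure.restrict_univ, add_sub_cancel_right] at this
      rw [← this]
      refine setIntegral_eq_of_subset_of_forall_sdiff_eq_zero
        (hRo.preimage (continuous_id.add continuous_const)).measurableSet hUR' ?_
      intro x hx
      rw [hz x hx.2, mul_zero]
    have i1 : Integrable (fun x => u x * θ x) (volume.restrict U) :=
      hw1.integrable_mul (hm.restrict U)
    have i2 : Integrable (fun x => u (x + h) * θ x) (volume.restrict U) :=
      hw2.integrable_mul (hm.restrict U)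
    simp only [Pi.sub_apply, sub_mul]
    rw [integral_sub i2 i1, ← e1, ← e2, hn]
    exact hu.integral_mul_sub_translate_le hb hR h1 h2 h3

theorem eLpNorm_two_sq {α E : Type*} [MeasurableSpace α] [NormedAddCommGroup E] (μ : Measure α)
    (f : α → E) : eLpNorm f 2 μ ^ 2 = ∫⁻ x, ‖f x‖ₑ ^ 2 ∂μ := by
  rw [eLpNorm_eq_lintegral_rpow_enorm_toReal (by norm_num) (by norm_num)]
  simp only [ENNReal.toReal_ofNat, ENNReal.rpow_two]
  rw [← ENNReal.rpow_two, ← ENNReal.rpow_mul]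
  simp

theorem IsSobolev.lintegral_sub_translate_le {R U : Set Plane} {u : Plane → ℝ} {G : Plane → Plane}
    (hRo : IsOpen R) (hb : volume R ≠ ⊤) (hu : IsSobolev R u G) (hU : IsOpen U) {h : Plane}
    (hR : ∀ x ∈ U, ∀ s ∈ Icc (0 : ℝ) 1, x + s • h ∈ R) :
    ∫⁻ x in U, ‖u (x + h) - u x‖ₑ ^ 2 ≤ ‖h‖ₑ ^ 2 * ∫⁻ x in R, ‖G x‖ₑ ^ 2 := by
  rw [← eLpNorm_two_sq, ← eLpNorm_two_sq, ← mul_pow]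
  gcongr
  exact hu.eLpNorm_sub_translate_le hRo hb hU hR

/-! ### The Poincaré inequality on balls and compact subsets. -/

theorem enorm_sub_sq_le (a b c : ℝ) : ‖a - c‖ₑ ^ 2 ≤ 2 * ‖a - b‖ₑ ^ 2 + 2 * ‖b - c‖ₑ ^ 2 := by
  have h2 : (2 : ENNReal) = ENNReal.ofReal 2 := by simp
  have e : ∀ x : ℝ, ‖x‖ₑ ^ 2 = ENNReal.ofReal (x ^ 2) := fun x => by
    rw [Real.enorm_eq_ofReal_abs, ← ENNReal.ofReal_pow (abs_nonneg x), sq_abs]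
  rw [e, e, e, h2, ← ENNReal.ofReal_mul (by norm_num), ← ENNReal.ofReal_mul (by norm_num),
    ← ENNReal.ofReal_add (by positivity) (by positivity)]
  apply ENNReal.ofReal_le_ofReal
  nlinarith [sq_nonneg (a - b - (b - c))]

/-- On `U`, every `u ∈ H¹(R)` is close to a constant, with error controlled by its gradient. -/
def PoincareOn (R U : Set Plane) : Prop :=
  ∃ C : ENNReal, C ≠ ⊤ ∧ ∀ u G, IsSobolev R u G →
    ∃ a : ℝ, ∫⁻ x in U, ‖u x - a‖ₑ ^ 2 ≤ C * ∫⁻ x in R, ‖G x‖ₑ ^ 2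

theorem PoincareOn.mono {R U V : Set Plane} (h : PoincareOn R V) (hUV : U ⊆ V) :
    PoincareOn R U := by
  obtain ⟨C, hC, h⟩ := h
  refine ⟨C, hC, fun u G hu => ?_⟩
  obtain ⟨a, ha⟩ := h u G hu
  exact ⟨a, (lintegral_mono_set hUV).trans ha⟩

theorem lintegral_enorm_sub_const_le (W : Set Plane) (u : Plane → ℝ) (a b : ℝ) :
    ∫⁻ x in W, ‖u x - a‖ₑ ^ 2 ≤
      2 * (∫⁻ x in W, ‖u x - b‖ₑ ^ 2) + 2 * ‖b - a‖ₑ ^ 2 * volume W := by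
  calc ∫⁻ x in W, ‖u x - a‖ₑ ^ 2
      ≤ ∫⁻ x in W, (2 * ‖u x - b‖ₑ ^ 2 + 2 * ‖b - a‖ₑ ^ 2) :=
        lintegral_mono fun x => enorm_sub_sq_le _ _ _
    _ = _ := by
        rw [lintegral_add_right _ measurable_const, lintegral_const_mul' _ _ (by simp)]
        simp

/-- The constants for `U` and `V` are both close to the function on the intersection. As that has
positive measure, they are close to each other, and the constant for `U` also serves on `V`. -/
theorem PoincareOn.union {R U V : Set Plane} (hb : volume R ≠ ⊤) (hU : PoincareOn R U)
    (hV : PoincareOn R V) (hVR : V ⊆ R) (hUV : volume (U ∩ V) ≠ 0) :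
    PoincareOn R (U ∪ V) := by
  obtain ⟨C, hC, hU⟩ := hU
  obtain ⟨D, hD, hV⟩ := hV
  have hVt : volume V ≠ ⊤ := ((measure_mono hVR).trans_lt hb.lt_top).ne
  have hKt : volume (U ∩ V) ≠ ⊤ := ((measure_mono inter_subset_right).trans_lt hVt.lt_top).ne
  refine ⟨C + (2 * D + 2 * ((2 * D + 2 * C) / volume (U ∩ V)) * volume V), ?_, fun u G hu => ?_⟩
  · refine ENNReal.add_ne_top.2 ⟨hC, ENNReal.add_ne_top.2 ⟨ENNReal.mul_ne_top (by simp) hD,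
      ENNReal.mul_ne_top (ENNReal.mul_ne_top (by simp) (ENNReal.div_ne_top ?_ hUV)) hVt⟩⟩
    exact ENNReal.add_ne_top.2 ⟨ENNReal.mul_ne_top (by simp) hD, ENNReal.mul_ne_top (by simp) hC⟩
  obtain ⟨a, ha⟩ := hU u G hu
  obtain ⟨b, hb⟩ := hV u G hu
  set I := ∫⁻ x in R, ‖G x‖ₑ ^ 2
  have hum : ∀ W ⊆ R, AEStronglyMeasurable u (volume.restrict W) := fun W hW =>
    hu.memLp.1.mono_measure (Measure.restrict_mono hW le_rfl)
  have hab : ‖b - a‖ₑ ^ 2 ≤ (2 * D + 2 * C) / volume (U ∩ V) * I := by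
    rw [← ENNReal.mul_div_right_comm, ENNReal.le_div_iff_mul_le (Or.inl hUV) (Or.inl hKt)]
    have hW := hum (U ∩ V) (inter_subset_right.trans hVR)
    calc ‖b - a‖ₑ ^ 2 * volume (U ∩ V) = ∫⁻ x in U ∩ V, ‖b - a‖ₑ ^ 2 := by simp
      _ ≤ ∫⁻ x in U ∩ V, (2 * ‖u x - b‖ₑ ^ 2 + 2 * ‖u x - a‖ₑ ^ 2) := by
          refine lintegral_mono fun x => ?_
          rw [← enorm_neg (u x - b), neg_sub]
          exact enorm_sub_sq_le _ _ _
      _ = 2 * (∫⁻ x in U ∩ V, ‖u x - b‖ₑ ^ 2) + 2 * (∫⁻ x in U ∩ V, ‖u x - a‖ₑ ^ 2) := by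
          rw [lintegral_add_left', lintegral_const_mul' _ _ (by simp),
            lintegral_const_mul' _ _ (by simp)]
          exact ((hW.sub aestronglyMeasurable_const).enorm.pow_const 2).const_mul 2
      _ ≤ 2 * (D * I) + 2 * (C * I) := by
          gcongr
          · exact (lintegral_mono_set inter_subset_right).trans hb
          · exact (lintegral_mono_set inter_subset_left).trans ha
      _ = (2 * D + 2 * C) * I := by ring
  refine ⟨a, ?_⟩
  calc ∫⁻ x in U ∪ V, ‖u x - a‖ₑ ^ 2
      ≤ (∫⁻ x in U, ‖u x - a‖ₑ ^ 2) + ∫⁻ x in V, ‖u x - a‖ₑ ^ 2 := lintegral_union_le _ _ _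
    _ ≤ C * I + (2 * (∫⁻ x in V, ‖u x - b‖ₑ ^ 2) + 2 * ‖b - a‖ₑ ^ 2 * volume V) := by
        gcongr
        exact lintegral_enorm_sub_const_le V u a b
    _ ≤ C * I + (2 * (D * I) + 2 * ((2 * D + 2 * C) / volume (U ∩ V) * I) * volume V) := by
        gcongr
    _ = _ := by ring

theorem IsSobolev.congr {R : Set Plane} {u v : Plane → ℝ} {G H : Plane → Plane}
    (h : IsSobolev R u G) (huv : u =ᵐ[volume.restrict R] v) (hGH : G =ᵐ[volume.restrict R] H) :
    IsSobolev R v H where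
  memLp := h.memLp.ae_eq huv
  memLp_grad := h.memLp_grad.ae_eq hGH
  hasWeakGradient θ h1 h2 h3 e := by
    have := h.hasWeakGradient θ h1 h2 h3 e
    rw [integral_congr_ae (huv.mono fun x hx => ?_), this,
      integral_congr_ae (hGH.mono fun x hx => ?_)]
    all_goals simp [hx]

/-- The double integral of the squared difference over `B × B` becomes, in the variable `h = x - y`,
an integral of translation estimates over `‖h‖ < 2r`. Some `y` does no worse than the average, and
the value there is the constant. -/
theorem poincareOn_ball {R : Set Plane} (hRo : IsOpen R) (hb : volume R ≠ ⊤) {x₀ : Plane} {r : ℝ}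
    (hr : 0 < r) (hB : Metric.ball x₀ r ⊆ R) : PoincareOn R (Metric.ball x₀ r) := by
  set B := Metric.ball x₀ r with hBdef
  have hB0 : volume B ≠ 0 := (Metric.measure_ball_pos _ _ hr).ne'
  have hBt : volume B ≠ ⊤ := ((measure_mono hB).trans_lt hb.lt_top).ne
  have hBm : MeasurableSet B := measurableSet_ball
  have h2t : volume (Metric.ball (0 : Plane) (2 * r)) ≠ ⊤ := measure_ball_lt_top.ne
  refine ⟨ENNReal.ofReal (2 * r) ^ 2 * volume (Metric.ball (0 : Plane) (2 * r)) / volume B,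
    ENNReal.div_ne_top (ENNReal.mul_ne_top (by finiteness) h2t) hB0, fun u₀ G hu₀ => ?_⟩
  -- A Borel measurable representative makes the integrand jointly measurable, as Tonelli requires.
  obtain ⟨u, hum, huu⟩ := hu₀.memLp.1.aemeasurable
  have hu : IsSobolev R u G := hu₀.congr huu (ae_eq_refl _)
  have huB : u₀ =ᵐ[volume.restrict B] u := ae_mono (Measure.restrict_mono hB le_rfl) huu
  set I := ∫⁻ x in R, ‖G x‖ₑ ^ 2
  let g : Plane × Plane → ENNReal := (B ×ˢ B).indicator fun p => ‖u p.2 - u p.1‖ₑ ^ 2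
  have hg : Measurable g := by
    refine Measurable.indicator ?_ (hBm.prod hBm)
    fun_prop
  have hD : ∫⁻ y in B, ∫⁻ x in B, ‖u x - u y‖ₑ ^ 2 ≤
      ENNReal.ofReal (2 * r) ^ 2 * volume (Metric.ball (0 : Plane) (2 * r)) * I := by
    calc ∫⁻ y in B, ∫⁻ x in B, ‖u x - u y‖ₑ ^ 2
        = ∫⁻ y, ∫⁻ x, g (y, x) := by
          rw [← lintegral_indicator hBm]
          congr 1 with y
          by_cases hy : y ∈ B
          · rw [indicator_of_mem hy, ← lintegral_indicator hBm]
            congr 1 with x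
            by_cases hx : x ∈ B <;> simp [g, indicator, hx, hy]
          · simp [g, indicator, hy]
      _ = ∫⁻ y, ∫⁻ h, g (y, y + h) := by
          congr 1 with y
          rw [lintegral_add_left_eq_self (fun x => g (y, x)) y]
      _ = ∫⁻ h, ∫⁻ y, g (y, y + h) := by
          apply lintegral_lintegral_swap
          exact (hg.comp (by fun_prop : Measurable fun p : Plane × Plane => (p.1, p.1 + p.2))).aemeasurable
      _ ≤ ∫⁻ h, (Metric.ball (0 : Plane) (2 * r)).indicator
            (fun _ => ENNReal.ofReal (2 * r) ^ 2 * I) h := by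
          refine lintegral_mono fun h => ?_
          by_cases hh : h ∈ Metric.ball (0 : Plane) (2 * r)
          · rw [indicator_of_mem hh]
            have hUo : IsOpen (B ∩ (fun y => y + h) ⁻¹' B) :=
              Metric.isOpen_ball.inter (Metric.isOpen_ball.preimage
                (continuous_id.add continuous_const))
            have e : ∫⁻ y, g (y, y + h) =
                ∫⁻ y in B ∩ (fun y => y + h) ⁻¹' B, ‖u (y + h) - u y‖ₑ ^ 2 := by
              rw [← lintegral_indicator hUo.measurableSet]
              rfl
            rw [e]
            refine (hu.lintegral_sub_translate_le hRo hb hUo ?_).trans ?_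
            · intro x hx s hs
              -- Convexity of the ball keeps the whole segment of translates inside `R`.
              have hc := (convex_ball x₀ r).add_smul_sub_mem hx.1 hx.2 hs
              simp only [add_sub_cancel_left] at hc
              exact hB hc
            · gcongr
              rw [← ofReal_norm]
              exact ENNReal.ofReal_le_ofReal (mem_ball_zero_iff.1 hh).le
          · rw [indicator_of_notMem hh]
            refine le_of_eq (lintegral_eq_zero_of_ae_eq_zero (Filter.Eventually.of_forall fun y => ?_))
            refine indicator_of_notMem (fun hy => hh ?_) _
            obtain ⟨h1, h2⟩ := hy
            simp only [hBdef, Metric.mem_ball, dist_eq_norm] at h1 h2 ⊢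
            calc ‖h - 0‖ = ‖(y + h - x₀) - (y - x₀)‖ := by congr 1; abel
              _ ≤ ‖y + h - x₀‖ + ‖y - x₀‖ := norm_sub_le _ _
              _ < 2 * r := by linarith
      _ = _ := by
          rw [lintegral_indicator measurableSet_ball]
          simp only [lintegral_const, Measure.restrict_apply_univ]
          ring
  have hFm : AEMeasurable (fun y => ∫⁻ x in B, ‖u x - u y‖ₑ ^ 2) (volume.restrict B) :=
    (Measurable.lintegral_prod_right' (f := fun p : Plane × Plane => ‖u p.2 - u p.1‖ₑ ^ 2)
      (by fun_prop)).aemeasurable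
  obtain ⟨y, hy, hle⟩ := exists_le_setLAverage hB0 hBt hFm
  refine ⟨u y, ?_⟩
  have e : ∫⁻ x in B, ‖u₀ x - u y‖ₑ ^ 2 = ∫⁻ x in B, ‖u x - u y‖ₑ ^ 2 :=
    lintegral_congr_ae (huB.mono fun x hx => by simp only [hx])
  rw [e]
  refine hle.trans ?_
  rw [setLAverage_eq, ENNReal.div_eq_inv_mul, ENNReal.div_eq_inv_mul, mul_assoc]
  gcongr

theorem volume_ball_inter_ne_zero {U V : Set Plane} {x : Plane} {r : ℝ} (hr : 0 < r)
    (hU : Metric.ball x r ⊆ U) (hV : Metric.ball x r ⊆ V) : volume (U ∩ V) ≠ 0 :=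
  ((Metric.measure_ball_pos volume x hr).trans_le (measure_mono (subset_inter hU hV))).ne'

/-- The relation holds for nearby points, is symmetric, and is transitive because two unions share a
ball about the middle point; connectedness then links any two points. -/
theorem exists_poincareOn_ball_union_ball {R : Set Plane} (hRo : IsOpen R) (hRc : IsPreconnected R)
    (hb : volume R ≠ ⊤) {x y : Plane} (hx : x ∈ R) (hy : y ∈ R) :
    ∃ r > 0, Metric.ball x r ⊆ R ∧ Metric.ball y r ⊆ R ∧
      PoincareOn R (Metric.ball x r ∪ Metric.ball y r) := by
  refine hRc.induction₂ (fun x y => ∃ r > 0, Metric.ball x r ⊆ R ∧ Metric.ball y r ⊆ R ∧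
      PoincareOn R (Metric.ball x r ∪ Metric.ball y r)) ?_ ?_ ?_ hx hy
  · intro x hx
    obtain ⟨r, hr, hxr⟩ := Metric.isOpen_iff.1 hRo x hx
    filter_upwards [mem_nhdsWithin_of_mem_nhds (Metric.ball_mem_nhds x (half_pos hr))] with y hy
    have h1 : Metric.ball x (r / 2) ⊆ Metric.ball x r := Metric.ball_subset_ball (by linarith)
    have h2 : Metric.ball y (r / 2) ⊆ Metric.ball x r := by
      refine Metric.ball_subset_ball' ?_
      rw [Metric.mem_ball] at hy
      linarith
    exact ⟨r / 2, half_pos hr, h1.trans hxr, h2.trans hxr,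
      (poincareOn_ball hRo hb hr hxr).mono (union_subset h1 h2)⟩
  · rintro x y z - - - ⟨r, hr, hx, hy, h⟩ ⟨s, hs, hy', hz, h'⟩
    have hm := lt_min hr hs
    have h1 : ∀ w : Plane, Metric.ball w (min r s) ⊆ Metric.ball w r := fun w =>
      Metric.ball_subset_ball (min_le_left _ _)
    have h2 : ∀ w : Plane, Metric.ball w (min r s) ⊆ Metric.ball w s := fun w =>
      Metric.ball_subset_ball (min_le_right _ _)
    refine ⟨min r s, hm, (h1 x).trans hx, (h2 z).trans hz, ?_⟩
    refine (h.union hb h' (union_subset hy' hz) (volume_ball_inter_ne_zero hm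
      ((h1 y).trans subset_union_right) ((h2 y).trans subset_union_left))).mono ?_
    exact union_subset_union ((h1 x).trans subset_union_left) ((h2 z).trans subset_union_right)
  · rintro x y - - ⟨r, hr, hx, hy, h⟩
    exact ⟨r, hr, hy, hx, union_comm _ _ ▸ h⟩

theorem poincareOn_of_isCompact {R K : Set Plane} (hRo : IsOpen R) (hRc : IsConnected R)
    (hb : volume R ≠ ⊤) (hK : IsCompact K) (hKR : K ⊆ R) : PoincareOn R K := by
  obtain ⟨x₀, hx₀⟩ := hRc.nonempty
  obtain ⟨r, hr, h1, h⟩ : ∃ r > 0, Metric.ball x₀ r ⊆ R ∧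
      PoincareOn R (Metric.ball x₀ r ∪ (K ∩ R)) := by
    -- Keeping a ball about the fixed point `x₀` in every piece makes any two pieces meet in
    -- positive measure, so that they can be joined.
    refine hK.induction_on (p := fun S => ∃ r > 0, Metric.ball x₀ r ⊆ R ∧
      PoincareOn R (Metric.ball x₀ r ∪ (S ∩ R))) ?_ ?_ ?_ ?_
    · obtain ⟨r, hr, hxr⟩ := Metric.isOpen_iff.1 hRo x₀ hx₀
      exact ⟨r, hr, hxr, by simpa using poincareOn_ball hRo hb hr hxr⟩
    · rintro S T hST ⟨r, hr, h1, h⟩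
      exact ⟨r, hr, h1, h.mono (by gcongr)⟩
    · rintro S T ⟨r, hr, h1, h⟩ ⟨s, hs, h1', h'⟩
      have a1 : Metric.ball x₀ (min r s) ⊆ Metric.ball x₀ r :=
        Metric.ball_subset_ball (min_le_left _ _)
      have a2 : Metric.ball x₀ (min r s) ⊆ Metric.ball x₀ s :=
        Metric.ball_subset_ball (min_le_right _ _)
      refine ⟨min r s, lt_min hr hs, a1.trans h1, ?_⟩
      refine (h.union hb h' (union_subset h1' inter_subset_right) (volume_ball_inter_ne_zero
        (lt_min hr hs) (a1.trans subset_union_left) (a2.trans subset_union_left))).mono ?_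
      rw [union_inter_distrib_right]
      refine union_subset ((a1.trans subset_union_left).trans subset_union_left) ?_
      exact union_subset_union subset_union_right subset_union_right
    · intro x hx
      obtain ⟨r, hr, h1, h2, h⟩ := exists_poincareOn_ball_union_ball hRo hRc.2 hb hx₀ (hKR hx)
      exact ⟨Metric.ball x r, mem_nhdsWithin_of_mem_nhds (Metric.ball_mem_nhds x hr), r, hr, h1,
        h.mono (union_subset_union le_rfl inter_subset_left)⟩
  exact h.mono fun x hx => Or.inr ⟨hx, hKR hx⟩

/-! ### The Poincaré inequality up to the boundary. -/

/-- Near a boundary point, a set with graph boundary can be shifted into a compact subset. -/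
theorem HasGraphBoundary.exists_shift {P : (ℝ → ℝ) → Prop} (hP : ∀ γ, P γ → Continuous γ)
    {R : Set Plane} (hR : HasGraphBoundary P R) {p : Plane} (hp : p ∈ frontier R) :
    ∃ (ρ : ℝ) (e : Plane) (K : Set Plane), 0 < ρ ∧ IsCompact K ∧ K ⊆ R ∧
      (∀ x ∈ R ∩ Metric.ball p ρ, x + e ∈ K) ∧
      ∀ x ∈ R ∩ Metric.ball p ρ, ∀ s ∈ Icc (0 : ℝ) 1, x + s • e ∈ R := by
  obtain ⟨A, γ, r, hγ, hr, h⟩ := hR p hp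
  have hγ := hP γ hγ
  let e₁ : Plane := EuclideanSpace.single 1 1
  -- A shift of length `r / 3` from the ball of radius `r / 3` stays in the chart of radius `r`.
  let e : Plane := (r / 3) • A.symm e₁
  have hen : ‖e‖ = r / 3 := by
    simp [e, e₁, norm_smul, abs_of_pos hr]
  have hA0 : ∀ (x : Plane) (s : ℝ), A (x + s • e) 0 = A x 0 := fun x s => by
    simp [e, e₁]
  have hA1 : ∀ (x : Plane) (s : ℝ), A (x + s • e) 1 = A x 1 + s * (r / 3) := fun x s => by
    simp [e, e₁]
  have hball : ∀ x ∈ Metric.closedBall p (r / 3), ∀ s ∈ Icc (0 : ℝ) 1,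
      x + s • e ∈ Metric.ball p r := by
    intro x hx s hs
    rw [Metric.mem_ball, dist_eq_norm]
    rw [Metric.mem_closedBall, dist_eq_norm] at hx
    calc ‖x + s • e - p‖ = ‖(x - p) + s • e‖ := by congr 1; abel
      _ ≤ ‖x - p‖ + ‖s • e‖ := norm_add_le _ _
      _ ≤ r / 3 + 1 * (r / 3) := by
          rw [norm_smul, hen, Real.norm_of_nonneg hs.1]
          gcongr
          exact hs.2
      _ < r := by linarith
  -- The non-strict inequality makes `L` compact; the upward shift makes it strict, so the image
  -- lies in `R`.
  let L : Set Plane := {x | γ (A x 0) ≤ A x 1} ∩ Metric.closedBall p (r / 3)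
  have hL : IsCompact L := by
    refine (isCompact_closedBall p (r / 3)).inter_left (isClosed_le ?_ ?_) <;> fun_prop
  have hsub : ∀ x ∈ R ∩ Metric.ball p (r / 3), x ∈ L := fun x hx =>
    ⟨((h x (Metric.ball_subset_ball (by linarith) hx.2)).1 hx.1).le,
      Metric.ball_subset_closedBall hx.2⟩
  refine ⟨r / 3, e, (fun x => x + e) '' L, by positivity, hL.image (by fun_prop), ?_,
    fun x hx => ⟨x, hsub x hx, rfl⟩, fun x hx s hs => ?_⟩
  · rintro _ ⟨x, hx, rfl⟩
    have h0 := hA0 x 1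
    have h1 := hA1 x 1
    have hb := hball x hx.2 1 (by simp)
    rw [one_smul] at h0 h1 hb
    refine (h _ hb).2 ?_
    have := hx.1
    simp only [mem_ofPred_eq] at this
    rw [h0, h1]
    linarith
  · refine (h _ (hball x (Metric.ball_subset_closedBall hx.2) s hs)).2 ?_
    have := (h x (Metric.ball_subset_ball (by linarith) hx.2)).1 hx.1
    rw [hA0, hA1]
    nlinarith [hs.1]

/-- **Poincaré inequality** on a bounded domain with continuous graph boundary. -/
theorem poincareOn_self {P : (ℝ → ℝ) → Prop} (hP : ∀ γ, P γ → Continuous γ)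
    {R : Set Plane} (hR : HasGraphBoundary P R) (hD : IsBoundedDomain R) : PoincareOn R R := by
  have hRo := hD.isOpen
  have hb : volume R ≠ ⊤ := hD.isBounded.measure_lt_top.ne
  have hcomp : IsCompact (closure R) := hD.isBounded.isCompact_closure
  -- The estimate is uniform in `a`, so local pieces add up with no matching of constants; `a` is
  -- chosen afterwards, from the inequality on `K`.
  obtain ⟨K, hK, hKR, C, hC, h⟩ : ∃ K, IsCompact K ∧ K ⊆ R ∧ ∃ C : ENNReal, C ≠ ⊤ ∧
      ∀ u G, IsSobolev R u G → ∀ a : ℝ, ∫⁻ x in closure R ∩ R, ‖u x - a‖ₑ ^ 2 ≤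
        C * ((∫⁻ x in K, ‖u x - a‖ₑ ^ 2) + ∫⁻ x in R, ‖G x‖ₑ ^ 2) := by
    refine hcomp.induction_on (p := fun S => ∃ K, IsCompact K ∧ K ⊆ R ∧ ∃ C : ENNReal, C ≠ ⊤ ∧
      ∀ u G, IsSobolev R u G → ∀ a : ℝ, ∫⁻ x in S ∩ R, ‖u x - a‖ₑ ^ 2 ≤
        C * ((∫⁻ x in K, ‖u x - a‖ₑ ^ 2) + ∫⁻ x in R, ‖G x‖ₑ ^ 2)) ?_ ?_ ?_ ?_
    · exact ⟨∅, isCompact_empty, empty_subset _, 0, by simp, by simp⟩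
    · rintro S T hST ⟨K, hK, hKR, C, hC, h⟩
      exact ⟨K, hK, hKR, C, hC, fun u G hu a =>
        (lintegral_mono_set (inter_subset_inter_left _ hST)).trans (h u G hu a)⟩
    · rintro S T ⟨K, hK, hKR, C, hC, h⟩ ⟨L, hL, hLR, D, hD, h'⟩
      refine ⟨K ∪ L, hK.union hL, union_subset hKR hLR, C + D, ENNReal.add_ne_top.2 ⟨hC, hD⟩,
        fun u G hu a => ?_⟩
      rw [union_inter_distrib_right, add_mul]
      refine (lintegral_union_le _ _ _).trans (add_le_add ((h u G hu a).trans ?_)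
        ((h' u G hu a).trans ?_))
      · gcongr
        exact subset_union_left
      · gcongr
        exact subset_union_right
    · intro p hp
      by_cases hpR : p ∈ R
      · obtain ⟨r, hr, hpr⟩ := Metric.nhds_basis_closedBall.mem_iff.1 (hRo.mem_nhds hpR)
        refine ⟨Metric.closedBall p r, mem_nhdsWithin_of_mem_nhds (Metric.closedBall_mem_nhds p hr),
          Metric.closedBall p r, isCompact_closedBall p r, hpr, 1, by simp, fun u G hu a => ?_⟩
        rw [one_mul]
        exact (lintegral_mono_set inter_subset_left).trans le_self_add
      · have hpf : p ∈ frontier R := by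
          rw [hRo.frontier_eq]
          exact ⟨hp, hpR⟩
        obtain ⟨ρ, e, K, hρ, hK, hKR, h1, h2⟩ := hR.exists_shift hP hpf
        refine ⟨Metric.ball p ρ, mem_nhdsWithin_of_mem_nhds (Metric.ball_mem_nhds p hρ), K, hK,
          hKR, 2 * ‖e‖ₑ ^ 2 + 2, by finiteness, fun u G hu a => ?_⟩
        rw [inter_comm]
        have hUo : IsOpen (R ∩ Metric.ball p ρ) := hRo.inter Metric.isOpen_ball
        have hUR : R ∩ Metric.ball p ρ ⊆ (fun x => x + e) ⁻¹' K := h1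
        have hmp : MeasurePreserving (fun x : Plane => x + e) volume volume :=
          measurePreserving_add_right volume e
        have hshift : ∫⁻ x in R ∩ Metric.ball p ρ, ‖u (x + e) - a‖ₑ ^ 2 ≤
            ∫⁻ x in K, ‖u x - a‖ₑ ^ 2 := by
          rw [← hmp.setLIntegral_comp_preimage_emb (measurableEmbedding_addRight e)
            (fun x => ‖u x - a‖ₑ ^ 2) K]
          exact lintegral_mono_set hUR
        have hm1 : AEStronglyMeasurable u (volume.restrict (R ∩ Metric.ball p ρ)) :=
          hu.memLp.1.mono_measure (Measure.restrict_mono inter_subset_left le_rfl)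
        have hm2 : AEStronglyMeasurable (fun x => u (x + e))
            (volume.restrict (R ∩ Metric.ball p ρ)) := by
          have := hu.memLp.1.comp_measurePreserving (hmp.restrict_preimage hRo.measurableSet)
          exact this.mono_measure (Measure.restrict_mono (hUR.trans (preimage_mono hKR)) le_rfl)
        calc ∫⁻ x in R ∩ Metric.ball p ρ, ‖u x - a‖ₑ ^ 2
            ≤ ∫⁻ x in R ∩ Metric.ball p ρ,
                (2 * ‖u (x + e) - u x‖ₑ ^ 2 + 2 * ‖u (x + e) - a‖ₑ ^ 2) := by
              refine lintegral_mono fun x => ?_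
              rw [← enorm_neg (u (x + e) - u x), neg_sub]
              exact enorm_sub_sq_le _ _ _
          _ = 2 * (∫⁻ x in R ∩ Metric.ball p ρ, ‖u (x + e) - u x‖ₑ ^ 2) +
                2 * ∫⁻ x in R ∩ Metric.ball p ρ, ‖u (x + e) - a‖ₑ ^ 2 := by
              rw [lintegral_add_left', lintegral_const_mul' _ _ (by simp),
                lintegral_const_mul' _ _ (by simp)]
              exact ((hm2.sub hm1).enorm.pow_const 2).const_mul 2
          _ ≤ 2 * (‖e‖ₑ ^ 2 * ∫⁻ x in R, ‖G x‖ₑ ^ 2) + 2 * ∫⁻ x in K, ‖u x - a‖ₑ ^ 2 := by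
              gcongr
              exact hu.lintegral_sub_translate_le hRo hb hUo h2
          _ ≤ (2 * ‖e‖ₑ ^ 2 + 2) * ((∫⁻ x in K, ‖u x - a‖ₑ ^ 2) + ∫⁻ x in R, ‖G x‖ₑ ^ 2) := by
              rw [mul_add, add_mul, add_mul, ← mul_assoc]
              set X := ∫⁻ x in K, ‖u x - a‖ₑ ^ 2
              set Y := ∫⁻ x in R, ‖G x‖ₑ ^ 2
              rw [add_comm (2 * ‖e‖ₑ ^ 2 * X + 2 * X)]
              exact add_le_add le_self_add le_add_self
  obtain ⟨D, hDt, hDK⟩ := poincareOn_of_isCompact hRo hD.isConnected hb hK hKR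
  refine ⟨C * (D + 1), by finiteness, fun u G hu => ?_⟩
  obtain ⟨a, ha⟩ := hDK u G hu
  refine ⟨a, ?_⟩
  have := h u G hu a
  rw [inter_eq_right.2 subset_closure] at this
  refine this.trans ?_
  rw [mul_assoc, add_mul, one_mul]
  gcongr

/-! ### The variational problem and its function space. -/

/-- This is Lax–Milgram for the form `⟨S p, S q⟩`, whose coercivity is `hS`. -/
theorem exists_forall_inner_map_eq {V W : Type*} [NormedAddCommGroup V] [InnerProductSpace ℝ V]
    [CompleteSpace V] [NormedAddCommGroup W] [InnerProductSpace ℝ W] (S : V →L[ℝ] W) {C : ℝ}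
    (hC : 0 < C) (hS : ∀ v, ‖v‖ ^ 2 ≤ C * ‖S v‖ ^ 2) (b : V) :
    ∃ p, ∀ q, inner ℝ (S p) (S q) = inner ℝ b q := by
  let B : V →L[ℝ] V →L[ℝ] ℝ := LinearMap.mkContinuous₂
    (LinearMap.mk₂ ℝ (fun p q => inner ℝ (S p) (S q))
      (fun _ _ _ => by rw [map_add, inner_add_left])
      (fun _ _ _ => by rw [map_smul, real_inner_smul_left, smul_eq_mul])
      (fun _ _ _ => by rw [map_add, inner_add_right])
      (fun _ _ _ => by rw [map_smul, real_inner_smul_right, smul_eq_mul]))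
    (‖S‖ * ‖S‖) (fun p q => by
      calc ‖inner ℝ (S p) (S q)‖ ≤ ‖S p‖ * ‖S q‖ := norm_inner_le_norm _ _
        _ ≤ (‖S‖ * ‖p‖) * (‖S‖ * ‖q‖) := by gcongr <;> exact S.le_opNorm _
        _ = _ := by ring)
  have hB : ∀ p q, B p q = inner ℝ (S p) (S q) := fun p q => rfl
  have hco : IsCoercive B := by
    refine ⟨C⁻¹, inv_pos.2 hC, fun u => ?_⟩
    rw [hB, real_inner_self_eq_norm_sq, mul_assoc, inv_mul_le_iff₀ hC, ← sq]
    exact hS u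
  refine ⟨hco.continuousLinearEquivOfBilin.symm b, fun q => ?_⟩
  rw [← hB, ← hco.continuousLinearEquivOfBilin_apply, ContinuousLinearEquiv.apply_symm_apply]

theorem exists_mem_orthogonal_forall_inner_map_eq {V W : Type*} [NormedAddCommGroup V]
    [InnerProductSpace ℝ V] [CompleteSpace V] [NormedAddCommGroup W] [InnerProductSpace ℝ W]
    (K : Submodule ℝ V) (S : V →L[ℝ] W) {C : ℝ}
    (hC : 0 < C) (hS : ∀ v ∈ Kᗮ, ‖v‖ ^ 2 ≤ C * ‖S v‖ ^ 2) (b : V) :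
    ∃ p ∈ Kᗮ, ∀ q ∈ Kᗮ, inner ℝ (S p) (S q) = inner ℝ b q := by
  obtain ⟨p, hp⟩ := exists_forall_inner_map_eq (S.comp Kᗮ.subtypeL) hC (fun v => hS v v.2)
    (Kᗮ.orthogonalProjectionOnto b)
  exact ⟨p, p.2, fun q hq => (hp ⟨q, hq⟩).trans
    (Submodule.inner_orthogonalProjectionOnto_eq_of_mem_right ⟨q, hq⟩ b)⟩

theorem lintegral_enorm_sq {α : Type*} [MeasurableSpace α] {μ : Measure α} {u : α → ℝ}
    (hu : MemLp u 2 μ) : ∫⁻ x, ‖u x‖ₑ ^ 2 ∂μ = ENNReal.ofReal (∫ x, u x ^ 2 ∂μ) := by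
  rw [ofReal_integral_eq_lintegral_ofReal hu.integrable_sq
    (Filter.Eventually.of_forall fun x => sq_nonneg _)]
  congr 1 with x
  rw [Real.enorm_eq_ofReal_abs, ← ENNReal.ofReal_pow (abs_nonneg _), sq_abs]

/-- Among constants, the mean is the best L² approximation; here it is zero. -/
theorem lintegral_enorm_sq_le_of_integral_eq_zero {α : Type*} [MeasurableSpace α] {μ : Measure α}
    [IsFiniteMeasure μ] {u : α → ℝ} (hu : MemLp u 2 μ) (h0 : ∫ x, u x ∂μ = 0) (a : ℝ) :
    ∫⁻ x, ‖u x‖ₑ ^ 2 ∂μ ≤ ∫⁻ x, ‖u x - a‖ₑ ^ 2 ∂μ := by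
  have hi : Integrable u μ := hu.integrable (by norm_num)
  have hua : MemLp (fun x => u x - a) 2 μ := hu.sub (memLp_const a)
  rw [lintegral_enorm_sq hu, lintegral_enorm_sq hua]
  apply ENNReal.ofReal_le_ofReal
  have e : ∀ x, (u x - a) ^ 2 = u x ^ 2 - (2 * a) * u x + a ^ 2 := fun x => by ring
  simp only [e]
  have i1 : Integrable (fun x => u x ^ 2 - (2 * a) * u x) μ :=
    hu.integrable_sq.sub (hi.const_mul _)
  rw [integral_add i1 (integrable_const _), integral_sub hu.integrable_sq (hi.const_mul _), integral_const_mul, h0]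
  simp only [integral_const, smul_eq_mul]
  have : 0 ≤ μ.real univ * a ^ 2 := by positivity
  linarith

/-- **Poincaré inequality** for functions of mean zero. -/
theorem PoincareOn.eLpNorm_le {R : Set Plane} (hP : PoincareOn R R) (hb : volume R ≠ ⊤) :
    ∃ C : ℝ, 0 ≤ C ∧ ∀ u G, IsSobolev R u G → ∫ x in R, u x = 0 →
      (eLpNorm u 2 (volume.restrict R)).toReal ^ 2 ≤
        C * (eLpNorm G 2 (volume.restrict R)).toReal ^ 2 := by
  have : IsFiniteMeasure (volume.restrict R) := ⟨by simpa using hb.lt_top⟩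
  obtain ⟨C, hC, h⟩ := hP
  refine ⟨C.toReal, ENNReal.toReal_nonneg, fun u G hu h0 => ?_⟩
  obtain ⟨a, ha⟩ := h u G hu
  have := (lintegral_enorm_sq_le_of_integral_eq_zero hu.memLp h0 a).trans ha
  rw [← eLpNorm_two_sq, ← eLpNorm_two_sq] at this
  rw [← ENNReal.toReal_pow, ← ENNReal.toReal_pow, ← ENNReal.toReal_mul]
  exact ENNReal.toReal_mono (ENNReal.mul_ne_top hC
    (ENNReal.pow_ne_top hu.memLp_grad.eLpNorm_lt_top.ne)) this

theorem hasWeakGradient_of_contDiff (R : Set Plane) {g : Plane → ℝ} (hg : ContDiff ℝ ∞ g) :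
    HasWeakGradient R g (gradient g) := by
  intro θ h1 h2 h3 e
  have hz : ∀ x ∉ R, θ x = 0 := fun x hx =>
    image_eq_zero_of_notMem_tsupport (fun hx' => hx (h3 hx'))
  have hz' : ∀ x ∉ R, fderiv ℝ θ x = 0 := fun x hx =>
    image_eq_zero_of_notMem_tsupport (fun hx' => hx (h3 (tsupport_fderiv_subset ℝ hx')))
  have c1 := (contDiff_fderiv_apply h1 e).continuous
  have c2 := (contDiff_fderiv_apply hg e).continuous
  simp only [inner_gradient_left]
  rw [setIntegral_eq_integral_of_forall_compl_eq_zero (fun x hx => by simp [hz' x hx]),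
    setIntegral_eq_integral_of_forall_compl_eq_zero (fun x hx => by simp [hz x hx])]
  refine integral_mul_fderiv_eq_neg_fderiv_mul_of_integrable ?_ ?_ ?_ ?_ ?_
  · exact (c2.mul h1.continuous).integrable_of_hasCompactSupport h2.mul_left
  · exact (hg.continuous.mul c1).integrable_of_hasCompactSupport
      (h2.fderiv_apply (𝕜 := ℝ) e).mul_left
  · exact (hg.continuous.mul h1.continuous).integrable_of_hasCompactSupport h2.mul_left
  · exact fun x _ => hg.differentiable (by simp) x
  · exact fun x _ => h1.differentiable (by simp) x

theorem isSobolev_of_contDiff (R : Set Plane) {g : Plane → ℝ} (hg : ContDiff ℝ ∞ g)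
    (hc : HasCompactSupport g) : IsSobolev R g (gradient g) where
  memLp := (hg.continuous.memLp_of_hasCompactSupport hc).restrict R
  memLp_grad := by
    refine Continuous.memLp_of_hasCompactSupport ?_ ?_ |>.restrict R
    · exact (InnerProductSpace.toDual ℝ Plane).symm.continuous.comp
        (hg.continuous_fderiv (by simp))
    · exact (hc.fderiv (𝕜 := ℝ)).comp_left (map_zero (InnerProductSpace.toDual ℝ Plane).symm)
  hasWeakGradient := hasWeakGradient_of_contDiff R hg

theorem IsSobolev.sub_const {R : Set Plane} (hb : volume R ≠ ⊤) {u : Plane → ℝ}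
    {G : Plane → Plane} (hu : IsSobolev R u G) (a : ℝ) : IsSobolev R (fun x => u x - a) G where
  memLp := by
    have : IsFiniteMeasure (volume.restrict R) := ⟨by simpa using hb.lt_top⟩
    exact hu.memLp.sub (memLp_const a)
  memLp_grad := hu.memLp_grad
  hasWeakGradient θ h1 h2 h3 e := by
    have h := hasWeakGradient_of_contDiff R (contDiff_const (c := a)) θ h1 h2 h3 e
    have hm : MemLp (fun x => fderiv ℝ θ x e) 2 volume :=
      (contDiff_fderiv_apply h1 e).continuous.memLp_of_hasCompactSupport
        (h2.fderiv_apply (𝕜 := ℝ) e)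
    have i1 : Integrable (fun x => u x * fderiv ℝ θ x e) (volume.restrict R) :=
      hu.memLp.integrable_mul (hm.restrict R)
    have i2 : Integrable (fun x => a * fderiv ℝ θ x e) (volume.restrict R) :=
      (((contDiff_fderiv_apply h1 e).continuous.integrable_of_hasCompactSupport
        (h2.fderiv_apply (𝕜 := ℝ) e)).restrict).const_mul a
    simp only [sub_mul]
    rw [integral_sub i1 i2, h, hu.hasWeakGradient θ h1 h2 h3 e]
    simp [gradient_fun_const]

/-- The space `L²(R) × L²(R; ℝ²)`. -/
abbrev SobolevPair (R : Set Plane) : Type :=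
  WithLp 2 (Lp ℝ 2 (volume.restrict R) × Lp Plane 2 (volume.restrict R))

theorem SobolevPair.inner_eq {R : Set Plane} {p q : SobolevPair R} {f g : Plane → ℝ}
    {F G : Plane → Plane} (hf : p.fst =ᵐ[volume.restrict R] f)
    (hF : p.snd =ᵐ[volume.restrict R] F) (hg : q.fst =ᵐ[volume.restrict R] g)
    (hG : q.snd =ᵐ[volume.restrict R] G) :
    inner ℝ p q = (∫ x in R, g x * f x) + ∫ x in R, inner ℝ (G x) (F x) := by
  rw [WithLp.prod_inner_apply, L2.inner_def, L2.inner_def]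
  congr 1
  · apply integral_congr_ae
    filter_upwards [hf, hg] with x h1 h2
    change inner ℝ ((p.fst : Plane → ℝ) x) ((q.fst : Plane → ℝ) x) = _
    rw [h1, h2]
    simp
  · apply integral_congr_ae
    filter_upwards [hF, hG] with x h1 h2
    change inner ℝ ((p.snd : Plane → Plane) x) ((q.snd : Plane → Plane) x) = _
    rw [h1, h2, real_inner_comm]

/-- The pairs to which the members of `sobolevZero` are orthogonal. -/
def sobolevTests (R : Set Plane) : Set (SobolevPair R) :=
  {k | ∃ θ : Plane → ℝ, ContDiff ℝ ∞ θ ∧ HasCompactSupport θ ∧ tsupport θ ⊆ R ∧ ∃ e : Plane,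
    k.fst =ᵐ[volume.restrict R] (fun x => fderiv ℝ θ x e) ∧
    k.snd =ᵐ[volume.restrict R] fun x => θ x • e} ∪
  {k | k.fst =ᵐ[volume.restrict R] (fun _ => (1 : ℝ)) ∧
    k.snd =ᵐ[volume.restrict R] fun _ => (0 : Plane)}

/-- The functions in `H¹(R)` of mean zero, paired with their weak gradients. -/
noncomputable def sobolevZero (R : Set Plane) : Submodule ℝ (SobolevPair R) :=
  (Submodule.span ℝ (sobolevTests R))ᗮ

/-- Orthogonality to a pair `(∂ₑθ, θ e)` is the weak gradient identity, and orthogonality to `(1,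
0)` is mean zero. As an orthogonal complement the space is closed, hence complete. -/
theorem mem_sobolevZero_iff {R : Set Plane} (hb : volume R ≠ ⊤) {p : SobolevPair R}
    {u : Plane → ℝ} {G : Plane → Plane} (hu : p.fst =ᵐ[volume.restrict R] u)
    (hG : p.snd =ᵐ[volume.restrict R] G) :
    p ∈ sobolevZero R ↔ HasWeakGradient R u G ∧ ∫ x in R, u x = 0 := by
  have : IsFiniteMeasure (volume.restrict R) := ⟨by simpa using hb.lt_top⟩
  have huL : MemLp u 2 (volume.restrict R) := (Lp.memLp p.fst).ae_eq hu
  have hGL : MemLp G 2 (volume.restrict R) := (Lp.memLp p.snd).ae_eq hG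
  have key : ∀ θ : Plane → ℝ, ContDiff ℝ ∞ θ → HasCompactSupport θ → ∀ (e : Plane)
      (k : SobolevPair R), k.fst =ᵐ[volume.restrict R] (fun x => fderiv ℝ θ x e) →
      k.snd =ᵐ[volume.restrict R] (fun x => θ x • e) →
      inner ℝ k p = (∫ x in R, u x * fderiv ℝ θ x e) + ∫ x in R, inner ℝ (G x) e * θ x := by
    intro θ h1 h2 e k hk1 hk2
    rw [SobolevPair.inner_eq hk1 hk2 hu hG]
    simp only [real_inner_smul_right, mul_comm]
  have hspan : p ∈ sobolevZero R ↔ ∀ k ∈ sobolevTests R, inner ℝ k p = 0 := by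
    rw [sobolevZero, Submodule.mem_orthogonal]
    refine ⟨fun h k hk => h k (Submodule.subset_span hk), fun h k hk => ?_⟩
    induction hk using Submodule.span_induction with
    | mem x hx => exact h x hx
    | zero => exact inner_zero_left _
    | add x y _ _ hx hy => rw [inner_add_left, hx, hy, add_zero]
    | smul c x _ hx => rw [inner_smul_left, hx, mul_zero]
  rw [hspan]
  constructor
  · intro h
    constructor
    · intro θ h1 h2 h3 e
      have m1 : MemLp (fun x => fderiv ℝ θ x e) 2 (volume.restrict R) :=
        ((contDiff_fderiv_apply h1 e).continuous.memLp_of_hasCompactSupport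
          (h2.fderiv_apply (𝕜 := ℝ) e)).restrict R
      have m2 : MemLp (fun x => θ x • e) 2 (volume.restrict R) :=
        ((h1.continuous.smul continuous_const).memLp_of_hasCompactSupport h2.smul_right).restrict R
      let k : SobolevPair R := WithLp.toLp 2 (m1.toLp _, m2.toLp _)
      have := h k (Or.inl ⟨θ, h1, h2, h3, e, m1.coeFn_toLp, m2.coeFn_toLp⟩)
      rw [key θ h1 h2 e k m1.coeFn_toLp m2.coeFn_toLp] at this
      linarith
    · have m1 : MemLp (fun _ => (1 : ℝ)) 2 (volume.restrict R) := memLp_const 1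
      have m2 : MemLp (fun _ => (0 : Plane)) 2 (volume.restrict R) := memLp_const 0
      let k : SobolevPair R := WithLp.toLp 2 (m1.toLp _, m2.toLp _)
      have := h k (Or.inr ⟨m1.coeFn_toLp, m2.coeFn_toLp⟩)
      rw [SobolevPair.inner_eq (p := k) m1.coeFn_toLp m2.coeFn_toLp hu hG] at this
      simpa using this
  · rintro ⟨h, h0⟩ k (⟨θ, h1, h2, h3, e, hk1, hk2⟩ | ⟨hk1, hk2⟩)
    · rw [key θ h1 h2 e k hk1 hk2, h θ h1 h2 h3 e]
      ring
    · rw [SobolevPair.inner_eq hk1 hk2 hu hG]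
      simp [h0]

/-- The Neumann problem is solvable if the Poincaré inequality holds and the data have mean
zero. -/
theorem exists_isNeumannSolution {R : Set Plane} (hP : PoincareOn R R) (hb : volume R ≠ ⊤)
    (h0 : volume R ≠ 0) {f : Plane → ℝ} (hf : MemLp f 2 (volume.restrict R))
    (hf0 : ∫ x in R, f x = 0) : ∃ φ G, IsNeumannSolution R f φ G := by
  have : IsFiniteMeasure (volume.restrict R) := ⟨by simpa using hb.lt_top⟩
  obtain ⟨C, hC, h⟩ := hP.eLpNorm_le hb
  let S : SobolevPair R →L[ℝ] Lp Plane 2 (volume.restrict R) := WithLp.sndL 2 ℝ _ _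
  have hSp : ∀ p : SobolevPair R, S p = p.snd := fun p => rfl
  have hsob : ∀ p ∈ sobolevZero R, IsSobolev R p.fst p.snd ∧ ∫ x in R, p.fst x = 0 := by
    intro p hp
    have := (mem_sobolevZero_iff hb (ae_eq_refl _) (ae_eq_refl _)).1 hp
    exact ⟨⟨Lp.memLp _, Lp.memLp _, this.1⟩, this.2⟩
  have hS : ∀ p ∈ sobolevZero R, ‖p‖ ^ 2 ≤ (C + 1) * ‖S p‖ ^ 2 := by
    intro p hp
    have h1 := h _ _ (hsob p hp).1 (hsob p hp).2
    rw [← Lp.norm_def, ← Lp.norm_def] at h1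
    rw [WithLp.prod_norm_sq_eq_of_L2, hSp]
    linarith
  -- Pairing with `(f, 0)` is the functional given by integration against `f`.
  let F : SobolevPair R := WithLp.toLp 2 (hf.toLp f, 0)
  obtain ⟨p, hpz, hp⟩ := exists_mem_orthogonal_forall_inner_map_eq
    (Submodule.span ℝ (sobolevTests R)) S (by linarith : 0 < C + 1) hS F
  refine ⟨p.fst, p.snd, (hsob p hpz).1, fun v H hv => ?_, (hsob p hpz).2⟩
  -- A general test function is reduced to mean zero by subtracting `m`. This changes neither side,
  -- since `f` has mean zero.
  set m : ℝ := (∫ x in R, v x) / volume.real R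
  have hv' := hv.sub_const hb m
  have hvi : Integrable v (volume.restrict R) := hv.memLp.integrable (by norm_num)
  have hm0 : ∫ x in R, (v x - m) = 0 := by
    rw [integral_sub hvi (integrable_const _)]
    have : volume.real R ≠ 0 := (ENNReal.toReal_pos h0 hb).ne'
    simp only [integral_const, smul_eq_mul, measureReal_restrict_apply_univ, m]
    field_simp
    ring
  let q : SobolevPair R := WithLp.toLp 2 (hv'.memLp.toLp _, hv.memLp_grad.toLp _)
  have hq1 : q.fst =ᵐ[volume.restrict R] fun x => v x - m := hv'.memLp.coeFn_toLp
  have hq2 : q.snd =ᵐ[volume.restrict R] H := hv.memLp_grad.coeFn_toLp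
  have hq : q ∈ sobolevZero R :=
    (mem_sobolevZero_iff hb hq1 hq2).2 ⟨hv'.hasWeakGradient, hm0⟩
  have key : inner ℝ (S p) (S q) = inner ℝ F q := hp q hq
  have hF1 : F.fst =ᵐ[volume.restrict R] f := hf.coeFn_toLp
  have hF2 : F.snd =ᵐ[volume.restrict R] fun _ => (0 : Plane) := Lp.coeFn_zero _ _ _
  rw [SobolevPair.inner_eq hF1 hF2 hq1 hq2, hSp, hSp, L2.inner_def] at key
  have e1 : ∫ x in R, inner ℝ (p.snd x) (H x) = ∫ x in R, inner ℝ (p.snd x) (q.snd x) := by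
    apply integral_congr_ae
    filter_upwards [hq2] with x hx
    rw [hx]
  rw [e1, key]
  have i1 : Integrable (fun x => v x * f x) (volume.restrict R) := hv.memLp.integrable_mul hf
  have i2 : Integrable (fun x => m * f x) (volume.restrict R) :=
    (hf.integrable (by norm_num)).const_mul m
  simp only [sub_mul, inner_zero_right, integral_zero, add_zero]
  rw [integral_sub i1 i2, integral_const_mul, hf0, mul_zero, sub_zero]
  simp only [mul_comm]

/-! ### Vanishing on the boundary, and mollified indicators. -/

/-- Points strictly below the graph form an open set disjoint from `R`, hence from its closure, and
moving down from `p` enters it. A slit, with the domain on both sides, is thus excluded. -/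
theorem HasGraphBoundary.mem_closure_compl_closure {P : (ℝ → ℝ) → Prop}
    (hP : ∀ γ, P γ → Continuous γ) {R : Set Plane} (hR : HasGraphBoundary P R) (hRo : IsOpen R)
    {p : Plane} (hp : p ∈ frontier R) : p ∈ closure (closure R)ᶜ := by
  obtain ⟨A, γ, r, hγ, hr, h⟩ := hR p hp
  have hγ := hP γ hγ
  let W : Set Plane := Metric.ball p r ∩ {x | A x 1 < γ (A x 0)}
  have hW : IsOpen W := by
    refine Metric.isOpen_ball.inter (isOpen_lt ?_ ?_) <;> fun_prop
  have hWR : W ⊆ (closure R)ᶜ := by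
    rw [subset_compl_iff_disjoint_right]
    refine Disjoint.closure_right ?_ hW
    refine disjoint_left.2 fun x hx hxR => ?_
    exact lt_asymm ((h x hx.1).1 hxR) hx.2
  have hpR : p ∉ R := by
    rw [hRo.frontier_eq] at hp
    exact hp.2
  have hpA : A p 1 ≤ γ (A p 0) := not_lt.1 fun hlt => hpR ((h p (Metric.mem_ball_self hr)).2 hlt)
  let e : Plane := A.symm (EuclideanSpace.single 1 1)
  have hlim : Filter.Tendsto (fun s : ℝ => p - s • e) (nhdsWithin 0 (Ioi 0)) (nhds p) := by
    have : Filter.Tendsto (fun s : ℝ => p - s • e) (nhds 0) (nhds (p - (0 : ℝ) • e)) :=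
      Continuous.tendsto (by fun_prop) 0
    rw [zero_smul, sub_zero] at this
    exact this.mono_left nhdsWithin_le_nhds
  refine closure_mono hWR (mem_closure_of_tendsto hlim ?_)
  filter_upwards [hlim (Metric.ball_mem_nhds p hr), self_mem_nhdsWithin] with s hs hs0
  refine ⟨hs, ?_⟩
  have h0 : A (p - s • e) 0 = A p 0 := by simp [e]
  have h1 : A (p - s • e) 1 = A p 1 - s := by simp [e]
  have : 0 < s := hs0
  simp only [mem_ofPred_eq]
  rw [h0, h1]
  linarith

theorem HasGraphBoundary.eq_zero_of_notMem {P : (ℝ → ℝ) → Prop}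
    (hP : ∀ γ, P γ → Continuous γ) {R : Set Plane} (hR : HasGraphBoundary P R) (hRo : IsOpen R)
    {g : Plane → ℝ} (hg : Continuous g) (h0 : ∀ x ∉ closure R, g x = 0) {x : Plane} (hx : x ∉ R) :
    g x = 0 := by
  by_cases hxc : x ∈ closure R
  · have hxf : x ∈ frontier R := by
      rw [hRo.frontier_eq]
      exact ⟨hxc, hx⟩
    have hcl : IsClosed {x | g x = 0} := isClosed_eq hg continuous_const
    exact closure_minimal (s := (closure R)ᶜ) h0 hcl (hR.mem_closure_compl_closure hP hRo hxf)
  · exact h0 x hxc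

theorem IsMollifier.continuous_scaledMollifier {η : Plane → ℝ} (hη : IsMollifier η) (ε : ℝ) :
    Continuous (scaledMollifier η ε) :=
  continuous_const.mul (hη.contDiff.continuous.comp (continuous_const_smul _))

theorem IsMollifier.hasCompactSupport_scaledMollifier {η : Plane → ℝ} (hη : IsMollifier η)
    {ε : ℝ} (hε : ε ≠ 0) : HasCompactSupport (scaledMollifier η ε) := by
  have h : HasCompactSupport η :=
    (isCompact_closedBall _ _).of_isClosed_subset (isClosed_tsupport η) hη.tsupport_subset
  exact (h.comp_homeomorph (Homeomorph.smulOfNeZero ε⁻¹ (inv_ne_zero hε))).mul_left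

theorem IsMollifier.integral_scaledMollifier {η : Plane → ℝ} (hη : IsMollifier η)
    {ε : ℝ} (hε : ε ≠ 0) : ∫ x, scaledMollifier η ε x = 1 := by
  unfold scaledMollifier
  rw [integral_const_mul, Measure.integral_comp_inv_smul, hη.integral_eq_one]
  simp [hε]

theorem mollifiedIndicator_eq_convolution (η : Plane → ℝ) (ε : ℝ) (M : Set Plane) :
    mollifiedIndicator η ε M =
      convolution (M.indicator fun _ => (1 : ℝ)) (scaledMollifier η ε)
        (ContinuousLinearMap.mul ℝ ℝ) volume := by
  ext x
  simp only [mollifiedIndicator, convolution, ContinuousLinearMap.mul_apply', mul_comm]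

theorem integrable_indicator_one {M : Set Plane} (hM : IsBoundedDomain M) :
    Integrable (M.indicator fun _ => (1 : ℝ)) :=
  (integrable_indicator_iff hM.isOpen.measurableSet).2
    (integrableOn_const hM.isBounded.measure_lt_top.ne)

theorem IsMollifier.continuous_mollifiedIndicator {η : Plane → ℝ} (hη : IsMollifier η) {ε : ℝ}
    (hε : ε ≠ 0) {M : Set Plane} (hM : IsBoundedDomain M) :
    Continuous (mollifiedIndicator η ε M) := by
  rw [mollifiedIndicator_eq_convolution]
  exact (hη.hasCompactSupport_scaledMollifier hε).continuous_convolution_right _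
    (integrable_indicator_one hM).locallyIntegrable (hη.continuous_scaledMollifier ε)

theorem IsMollifier.integral_mollifiedIndicator {η : Plane → ℝ} (hη : IsMollifier η) {ε : ℝ}
    (hε : ε ≠ 0) {M : Set Plane} (hM : IsBoundedDomain M) :
    ∫ x, mollifiedIndicator η ε M x = area M := by
  rw [mollifiedIndicator_eq_convolution, integral_convolution _ (integrable_indicator_one hM)
    ((hη.continuous_scaledMollifier ε).integrable_of_hasCompactSupport
      (hη.hasCompactSupport_scaledMollifier hε)), hη.integral_scaledMollifier hε,
    integral_indicator hM.isOpen.measurableSet]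
  simp [area]

theorem IsBoundedDomain.area_pos {M : Set Plane} (hM : IsBoundedDomain M) : 0 < area M :=
  ENNReal.toReal_pos (hM.isOpen.measure_pos volume hM.isConnected.nonempty).ne'
    hM.isBounded.measure_lt_top.ne

/-- The energy of a Neumann solution is positive unless the data vanish. -/
theorem IsNeumannSolution.eqOn_zero_of_energy_eq_zero {R : Set Plane} (hRo : IsOpen R)
    {f φ : Plane → ℝ} {G : Plane → Plane} (h : IsNeumannSolution R f φ G) (hf : Continuous f)
    (hE : ∫ x in R, ‖G x‖ ^ 2 = 0) : EqOn f 0 R := by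
  have hG : G =ᵐ[volume.restrict R] 0 := by
    have := (integral_eq_zero_iff_of_nonneg (fun x => sq_nonneg ‖G x‖)
      ((memLp_two_iff_integrable_sq_norm h.isSobolev.memLp_grad.1).1 h.isSobolev.memLp_grad)).1 hE
    filter_upwards [this] with x hx
    simpa using hx
  have h0 : ∀ᵐ x, x ∈ R → f x = 0 := by
    refine hRo.ae_eq_zero_of_integral_contDiff_smul_eq_zero
      (hf.locallyIntegrable.locallyIntegrableOn R) fun θ h1 h2 h3 => ?_
    -- Test functions lie in H¹, and the gradient side of the weak equation is zero.
    have := h.weak_eq θ _ (isSobolev_of_contDiff R h1 h2)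
    rw [← setIntegral_eq_integral_of_forall_compl_eq_zero (s := R)]
    · simp only [smul_eq_mul, mul_comm (θ _)]
      rw [← this]
      refine integral_eq_zero_of_ae ?_
      filter_upwards [hG] with x hx
      simp [hx]
    · intro x hx
      rw [image_eq_zero_of_notMem_tsupport (fun hx' => hx (h3 hx')), zero_smul]
  exact Measure.eqOn_open_of_ae_eq ((ae_restrict_iff' hRo.measurableSet).2 h0) hRo
    hf.continuousOn continuousOn_const

end Floorplan

/-! ### Positivity of the energy. -/

theorem mainTheorem4 {n : ℕ} (R : Set Floorplan.Plane) (M : Fin n → Set Floorplan.Plane)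
    (η : Floorplan.Plane → ℝ) (ε : ℝ) (c : Fin n → Floorplan.Plane)
    (hR : Floorplan.IsSmoothBoundedDomain R)
    (hM : ∀ i, Floorplan.IsLipschitzBoundedDomain (M i))
    (hη : Floorplan.IsMollifier η)
    (hε : 0 < ε) (hεM : ∀ i, ε < Floorplan.inradius (M i))
    (hρ : Floorplan.averageDensity R M < 2)
    (hc : ∀ i, ∀ x ∉ closure R, Floorplan.mollifiedIndicator η ε (M i) (x - c i) = 0)
    (hO : 0 < volume (Floorplan.overlap M c)) :
    0 < Floorplan.mollifiedPoissonEnergy R η ε M c := by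
  obtain ⟨hD, hG⟩ := hR
  have hRo := hD.isOpen
  have hb : volume R ≠ ⊤ := hD.isBounded.measure_lt_top.ne
  have hR0 : volume R ≠ 0 := (hRo.measure_pos volume hD.isConnected.nonempty).ne'
  have hfin : IsFiniteMeasure (volume.restrict R) := ⟨by simpa using hb.lt_top⟩
  have hγ : ∀ γ : ℝ → ℝ, ContDiff ℝ ∞ γ → Continuous γ := fun γ h => h.continuous
  have hψc : ∀ i, Continuous fun x => Floorplan.mollifiedIndicator η ε (M i) (x - c i) := fun i =>
    (hη.continuous_mollifiedIndicator hε.ne' (hM i).1).comp (continuous_id.sub continuous_const)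
  have hψ0 : ∀ i, ∀ x ∉ R, Floorplan.mollifiedIndicator η ε (M i) (x - c i) = 0 := fun i x hx =>
    hG.eq_zero_of_notMem hγ hRo (hψc i) (hc i) hx
  have hψs : ∀ i, HasCompactSupport fun x => Floorplan.mollifiedIndicator η ε (M i) (x - c i) :=
    fun i => HasCompactSupport.intro hD.isBounded.isCompact_closure (hc i)
  have hψL : ∀ i, MemLp (fun x => Floorplan.mollifiedIndicator η ε (M i) (x - c i)) 2
      (volume.restrict R) := fun i =>
    ((hψc i).memLp_of_hasCompactSupport (hψs i)).restrict R
  have hψi : ∀ i, ∫ x in R, Floorplan.mollifiedIndicator η ε (M i) (x - c i) =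
      Floorplan.area (M i) := fun i => by
    rw [setIntegral_eq_integral_of_forall_compl_eq_zero (hψ0 i),
      integral_sub_right_eq_self, hη.integral_mollifiedIndicator hε.ne' (hM i).1]
  set f : Floorplan.Plane → ℝ := fun x =>
    Floorplan.mollifiedDensity η ε M c x - Floorplan.averageDensity R M with hf
  have hfc : Continuous f := (continuous_finsetSum _ fun i _ => hψc i).sub continuous_const
  have hρL : MemLp (Floorplan.mollifiedDensity η ε M c) 2 (volume.restrict R) :=
    memLp_finsetSum _ fun i _ => hψL i
  have hfL : MemLp f 2 (volume.restrict R) := hρL.sub (memLp_const _)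
  -- Each mollified module has all its mass in `R`, so its integral there is the full area: this is
  -- the compatibility condition.
  have hf0 : ∫ x in R, f x = 0 := by
    rw [hf, integral_sub (hρL.integrable (by norm_num)) (integrable_const _)]
    unfold Floorplan.mollifiedDensity
    rw [integral_finsetSum _ fun i _ => (hψL i).integrable (by norm_num)]
    have hA : Floorplan.area R ≠ 0 := hD.area_pos.ne'
    simp only [hψi, integral_const, measureReal_restrict_apply_univ, smul_eq_mul,
      Floorplan.averageDensity]
    change _ - Floorplan.area R * _ = 0
    field_simp
    ring
  obtain ⟨φ, G, hsol⟩ := Floorplan.exists_isNeumannSolution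
    (Floorplan.poincareOn_self hγ hG hD) hb hR0 hfL hf0
  have hE : Floorplan.mollifiedPoissonEnergy R η ε M c = 1 / 2 * ∫ x in R, ‖G x‖ ^ 2 :=
    (Floorplan.neumannEnergy_eq hsol).1
  have hnn : 0 ≤ ∫ x in R, ‖G x‖ ^ 2 := integral_nonneg fun x => sq_nonneg _
  rcases hnn.lt_or_eq with hpos | hzero
  · rw [hE]
    positivity
  exfalso
  have hfR := hsol.eqOn_zero_of_energy_eq_zero hRo hfc hzero.symm
  have hne : R ≠ univ := fun h => by
    have := hD.isBounded
    rw [h] at this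
    exact NormedSpace.unbounded_univ ℝ Floorplan.Plane this
  -- At a boundary point the residual is zero as a limit from `R`, while the density is zero there
  -- too; this forces the average density to be zero.
  obtain ⟨p, hp⟩ := nonempty_frontier_iff.2 ⟨hD.isConnected.nonempty, hne⟩
  have hfp : f p = 0 :=
    hfR.closure hfc continuous_const (frontier_subset_closure hp)
  have hpR : p ∉ R := by
    rw [hRo.frontier_eq] at hp
    exact hp.2
  have hρp : Floorplan.mollifiedDensity η ε M c p = 0 := Finset.sum_eq_zero fun i _ => hψ0 i p hpR
  -- A point of the overlap supplies an index `i`, so the sum of areas is over a nonempty set.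
  obtain ⟨x, hx⟩ := nonempty_of_measure_ne_zero hO.ne'
  simp only [Floorplan.overlap, mem_iUnion] at hx
  obtain ⟨i, -⟩ := hx
  have havg : 0 < Floorplan.averageDensity R M :=
    div_pos (Finset.sum_pos (fun i _ => (hM i).1.area_pos) ⟨i, Finset.mem_univ i⟩) hD.area_pos
  rw [hf] at hfp
  simp only [hρp] at hfp
  linarith
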